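/- All vector spaces are over $\mathbb{C}$. For finite-dimensional spaces $V_0,\dots,V_k$ and $W_0,\dots,W_k$, a tensor $T\in V_0\otimes\cdots\otimes V_k$ *degenerates* to $T'\in W_0\otimes\cdots\otimes W_k$ if $T'$ lies in the (Euclidean) closure of the set of all tensors $(A_0\otimes\cdots\otimes A_k)T$ with linear maps $A_j:V_j\to W_j$. The *border subrank* $\underline{\mathrm{Q}}(T)$ is the largest $m\in\mathbb{N}$ such that $T$ degenerates to the unit tensor $\sum_{i=1}^m e_i\otimes\cdots\otimes e_i\in(\mathbb{C}^m)^{\otimes(k+1)}$. Let $$\mathsf{MaMu}_{(n,\dots,n)}=\sum_{i_0,\dots,i_k=1}^n e_{i_0i_k}\otimes e_{i_0i_1}^*\otimes\cdots\otimes e_{i_{k-1}i_k}^*\in \mathrm{Mat}_{n\times n}\otimes(\mathrm{Mat}_{n\times n}^*)^{\otimes k}$$ be the tensor of the $k$-fold matrix multiplication $(X_1,\dots,X_k)\mapsto X_1\cdots X_k$ of $n\times n$ matrices. **Theorem.** Let $k\ge 3$ and $n\ge 2$ be integers, and let $q=\lfloor n/k\rfloor$ and $r=n-qk$. Then the border subrank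 of $\mathsf{MaMu}_{(n,\dots,n)}$ is well defined (a largest such $m$ exists), and $$\frac{n^2}{k-1}\ \le\ \underline{\mathrm{Q}}\bigl(\mathsf{MaMu}_{(n,\dots,n)}\bigr)\ \le\ \frac12\bigl(n^2+nq+r(q+1)\bigr).$$ -/

import Mathlib

open scoped TensorProduct

noncomputable section

/-- `T` degenerates to `T'`: the tensor `T'` lies in the closure of the set of restrictions
`(A₁ ⊗ ⋯ ⊗ Aₘ) T`, where `Aⱼ : Vⱼ → Wⱼ` are linear maps. The closure is taken in the canonical
(Euclidean) topology of the complex vector space `⨂ Wⱼ`, which for a finite-dimensional space is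
its module topology. When `Vⱼ = Wⱼ` this is the closure of the orbit of `T` under
`End(V₁) × ⋯ × End(Vₘ)`. -/
def DegeneratesTo {ι : Type*} {V W : ι → Type*}
    [∀ j, AddCommGroup (V j)] [∀ j, Module ℂ (V j)]
    [∀ j, AddCommGroup (W j)] [∀ j, Module ℂ (W j)]
    (T : ⨂[ℂ] j, V j) (T' : ⨂[ℂ] j, W j) : Prop :=
  T' ∈ @closure (⨂[ℂ] j, W j) (moduleTopology ℂ (⨂[ℂ] j, W j))
    (Set.range fun A : ∀ j, V j →ₗ[ℂ] W j => PiTensorProduct.map A T)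

/-- The unit tensor `∑ᵢ eᵢ ⊗ ⋯ ⊗ eᵢ` of rank `q`, whose tensor factors `ℂ^q` are indexed by `ι`. -/
def unitTensor (ι : Type*) (q : ℕ) : ⨂[ℂ] _ : ι, (Fin q → ℂ) :=
  ∑ i : Fin q, PiTensorProduct.tprod ℂ fun _ : ι => (Pi.single i 1 : Fin q → ℂ)

/-- The border subrank of `T`: the largest `q` such that `T` degenerates to the unit tensor of
rank `q`. -/
def borderSubrank {ι : Type*} {V : ι → Type*}
    [∀ j, AddCommGroup (V j)] [∀ j, Module ℂ (V j)] (T : ⨂[ℂ] j, V j) : ℕ :=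
  sSup {q : ℕ | DegeneratesTo T (unitTensor ι q)}

/-- The tensor factors of the iterated matrix multiplication tensor of format `(n₀, …, nₖ)`:
factor `0` is the space of `n₀ × nₖ` matrices, and factor `j + 1` is the dual of the space of
`nⱼ × nⱼ₊₁` matrices. -/
def MaMuSpace {k : ℕ} (n : Fin (k + 1) → ℕ) : Fin (k + 1) → Type :=
  Fin.cases (Matrix (Fin (n 0)) (Fin (n (Fin.last k))) ℂ)
    fun j : Fin k => Module.Dual ℂ (Matrix (Fin (n j.castSucc)) (Fin (n j.succ)) ℂ)

instance MaMuSpace.addCommGroup {k : ℕ} (n : Fin (k + 1) → ℕ) (j : Fin (k + 1)) :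
    AddCommGroup (MaMuSpace n j) :=
  Fin.cases (motive := fun j => AddCommGroup (MaMuSpace n j))
    (inferInstanceAs (AddCommGroup (Matrix (Fin (n 0)) (Fin (n (Fin.last k))) ℂ)))
    (fun j : Fin k => inferInstanceAs
      (AddCommGroup (Module.Dual ℂ (Matrix (Fin (n j.castSucc)) (Fin (n j.succ)) ℂ)))) j

instance MaMuSpace.module {k : ℕ} (n : Fin (k + 1) → ℕ) (j : Fin (k + 1)) :
    Module ℂ (MaMuSpace n j) :=
  Fin.cases (motive := fun j => Module ℂ (MaMuSpace n j))
    (inferInstanceAs (Module ℂ (Matrix (Fin (n 0)) (Fin (n (Fin.last k))) ℂ)))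
    (fun j : Fin k => inferInstanceAs
      (Module ℂ (Module.Dual ℂ (Matrix (Fin (n j.castSucc)) (Fin (n j.succ)) ℂ)))) j

/-- The iterated matrix multiplication tensor of format `(n₀, …, nₖ)`,
`∑ e_{i₀iₖ} ⊗ e*_{i₀i₁} ⊗ ⋯ ⊗ e*_{iₖ₋₁iₖ}`, which is the tensor of the multilinear map
`(X₁, …, Xₖ) ↦ X₁ ⋯ Xₖ`. -/
def MaMu {k : ℕ} (n : Fin (k + 1) → ℕ) : ⨂[ℂ] j, MaMuSpace n j :=
  ∑ i : (∀ j, Fin (n j)), PiTensorProduct.tprod ℂ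
    (Fin.cases (motive := MaMuSpace n)
      (Matrix.single (i 0) (i (Fin.last k)) (1 : ℂ))
      (fun j : Fin k => (Matrix.stdBasis ℂ (Fin (n j.castSucc)) (Fin (n j.succ))).coord
        (i j.castSucc, i j.succ)))

end

/-! Upper bound. Suppose the tensor degenerates to the unit tensor of rank m. Contracting all
factors but the first with the same vector y sends the unit tensor to (y_l ^ k), which has no zero
on the unit sphere. By compactness some actual restriction inherits this. Since the tensor encodes
X₁⋯Xₖ, there are linear maps X_j from ℂ^m to n × n matrices such that X₁(y)⋯Xₖ(y) = 0 only for y =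
0. So an m-dimensional linear space of k-tuples meets the cone of tuples with zero product only at
the origin, and m is at most the codimension of any family inside that cone.

Such a family comes from flags: tuples whose j-th matrix maps the j-th step to the next, from the
whole space down to 0. If s_j is the codimension of the j-th step, the family has codimension ∑
(s_{j+1} - s_j) s_{j+1}, which equals half of n² plus the sum of the squares of the jumps. Jumps of
size q and q + 1 give the stated bound. The dimension inequality is proved with a generic point of
the family: `isIntegral_coord_of_forall_eq_zero` makes its coordinates integral over k n² - m linear
forms, while its parameters are independent and rational in those coordinates.

Lower bound. A monomial degeneration keeps only the index tuples for which (i₁, …, iₖ) is an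
arithmetic progression of difference i₀ - o. Any two cyclically adjacent indices determine such a
tuple, so the surviving terms form a unit tensor. With o central there is one for each pair (i₁, iₖ)
congruent modulo k - 1, and Cauchy–Schwarz over residue classes counts at least n² / (k - 1) pairs.
-/

/-! ### Linear sections of cones: integrality and transcendence degree -/

/-- A point `x` over an extension field all of whose multiples satisfy the equations `p e` has
integral coordinates over the algebra generated by linear forms whose only common zero
satisfying the equations is the origin. -/
theorem isIntegral_coord_of_forall_eq_zero {F K σ ι E : Type*} [Field F] [IsAlgClosed F]
    [Field K] [Algebra F K] [Finite σ] (p : E → MvPolynomial σ F) (l : ι → MvPolynomial σ F)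
    (x : σ → K)
    (hl : ∀ (c : K) (i : ι), MvPolynomial.aeval (c • x) (l i) = c * MvPolynomial.aeval x (l i))
    (hx : ∀ (c : K) (e : E), MvPolynomial.aeval (c • x) (p e) = 0)
    (h : ∀ z : σ → F, (∀ e, MvPolynomial.aeval z (p e) = 0) →
      (∀ i, MvPolynomial.aeval z (l i) = 0) → z = 0) (a : σ) :
    IsIntegral (Algebra.adjoin F (Set.range fun i => MvPolynomial.aeval x (l i))) (x a) := by
  by_contra hna
  let R := Algebra.adjoin F (Set.range fun i => MvPolynomial.aeval x (l i))
  -- A valuation ring containing `R` but not `x a` plays the role of a point at infinity. Dividing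
  -- `x` by its largest coordinate and reducing modulo the maximal ideal gives a nonzero common zero
  -- of all the equations.
  obtain ⟨V, hRV, haV⟩ := Subring.exists_le_valuationSubring_of_isIntegrallyClosedIn
    (R := (integralClosure R K).toSubring) (x := x a) hna
  have hR : ∀ y ∈ R, y ∈ V := fun y hy =>
    hRV (show IsIntegral R y from isIntegral_algebraMap (x := (⟨y, hy⟩ : R)))
  have : Nonempty σ := ⟨a⟩
  obtain ⟨b, hb⟩ := Finite.exists_max fun s => V.valuation (x s)
  have hb1 : 1 < V.valuation (x b) := by
    refine lt_of_lt_of_le ?_ (hb a)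
    rw [← not_le, V.valuation_le_one_iff]
    exact haV
  have hxb : x b ≠ 0 := by
    intro h0
    simp [h0] at hb1
  let f : F →+* V := (algebraMap F K).codRestrict V.toSubring fun c =>
    hR _ (R.algebraMap_mem c)
  have hz : ∀ s, (x b)⁻¹ * x s ∈ V := fun s => by
    rw [← V.valuation_le_one_iff, map_mul, map_inv₀]
    exact inv_mul_le_one_of_le₀ (hb s) zero_le
  let z : σ → V := fun s => ⟨(x b)⁻¹ * x s, hz s⟩
  have hzK : ∀ q : MvPolynomial σ F, ((MvPolynomial.eval₂ f z q : V) : K) =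
      MvPolynomial.aeval ((x b)⁻¹ • x) q := fun q => by
    have := MvPolynomial.eval₂_comp_left V.subtype f z q
    rw [MvPolynomial.aeval_def]
    exact this
  let π := IsLocalRing.residue V
  have hπ : ∀ q : MvPolynomial σ F, MvPolynomial.eval₂ (π.comp f) (π ∘ z) q =
      π (MvPolynomial.eval₂ f z q) := fun q => (MvPolynomial.eval₂_comp_left π f z q).symm
  have hpz : ∀ e, MvPolynomial.eval₂ (π.comp f) (π ∘ z) (p e) = 0 := fun e => by
    rw [hπ]
    have : MvPolynomial.eval₂ f z (p e) = 0 := Subtype.ext (by rw [hzK, hx]; rfl)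
    rw [this, map_zero]
  have hlz : ∀ i, MvPolynomial.eval₂ (π.comp f) (π ∘ z) (l i) = 0 := fun i => by
    rw [hπ, IsLocalRing.residue_eq_zero_iff, V.valuation_lt_one_iff, hzK, hl, map_mul, map_inv₀]
    have h1 : V.valuation (MvPolynomial.aeval x (l i)) ≤ 1 := by
      rw [V.valuation_le_one_iff]
      exact hR _ (Algebra.subset_adjoin ⟨i, rfl⟩)
    exact lt_of_le_of_lt (mul_le_of_le_one_right' h1) (inv_lt_one_of_one_lt₀ hb1)
  -- The reduced point lives over the residue field, which may exceed `F`. The Nullstellensatz over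
  -- `F` turns the hypothesis `h` into an ideal membership, which can be evaluated there.
  let J : Ideal (MvPolynomial σ F) := Ideal.span (Set.range p ∪ Set.range l)
  have hJ : MvPolynomial.X b ∈ J.radical := by
    rw [← MvPolynomial.vanishingIdeal_zeroLocus_eq_radical (K := F),
      MvPolynomial.mem_vanishingIdeal_iff]
    intro y hy
    rw [MvPolynomial.zeroLocus_span] at hy
    have := h y (fun e => hy _ (Or.inl ⟨e, rfl⟩)) (fun i => hy _ (Or.inr ⟨i, rfl⟩))
    simp [this]
  obtain ⟨N, hN⟩ := hJ
  have hker : J ≤ RingHom.ker (MvPolynomial.eval₂Hom (π.comp f) (π ∘ z)) := by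
    rw [Ideal.span_le]
    rintro _ (⟨e, rfl⟩ | ⟨i, rfl⟩)
    · exact hpz e
    · exact hlz i
  have h1 := hker hN
  rw [RingHom.mem_ker, map_pow, MvPolynomial.coe_eval₂Hom, MvPolynomial.eval₂_X] at h1
  have h2 : z b = 1 := Subtype.ext (inv_mul_cancel₀ hxb)
  simp [h2] at h1

theorem card_le_card_of_isAlgebraic_adjoin.{u, v} {F : Type v} {K τ ι : Type u} [Field F] [Field K] [Algebra F K]
    [Fintype τ] [Fintype ι] (x : τ → K) (hx : AlgebraicIndependent F x) (y : ι → K)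
    (h : Algebra.IsAlgebraic (Algebra.adjoin F (Set.range y)) K) :
    Fintype.card τ ≤ Fintype.card ι := by
  have h2 := Algebra.IsAlgebraic.trdeg_le_cardinalMk F (Set.range y)
  have h3 := (hx.cardinalMk_le_trdeg.trans h2).trans Cardinal.mk_range_le
  rwa [Cardinal.mk_fintype, Cardinal.mk_fintype, Nat.cast_le] at h3

theorem Matrix.inv_mem_subfield {K ι : Type*} [Field K] [Fintype ι] [DecidableEq ι]
    (F : Subfield K) (M : Matrix ι ι K) (hM : ∀ i j, M i j ∈ F) (i j : ι) : M⁻¹ i j ∈ F := by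
  let M' : Matrix ι ι F := fun i j => ⟨M i j, hM i j⟩
  have hM' : F.subtype.mapMatrix M' = M := by ext i j; rfl
  by_cases hd : IsUnit M.det
  · have hd' : IsUnit M'.det := by
      rw [isUnit_iff_ne_zero] at hd ⊢
      intro h0
      apply hd
      rw [← hM', ← RingHom.map_det, h0, map_zero]
    have : M⁻¹ = F.subtype.mapMatrix M'⁻¹ := by
      apply Matrix.inv_eq_left_inv
      rw [← hM', ← map_mul, Matrix.nonsing_inv_mul _ hd', map_one]
    rw [this]
    exact (M'⁻¹ i j).2
  · rw [Matrix.nonsing_inv_apply_not_isUnit _ hd]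
    exact F.zero_mem

/-! ### Matrix tuples shifting a flag -/

section Flag

variable {K : Type*} [Field K] {n : ℕ}

/-- `M` maps row vectors supported on `[s, n)` to row vectors supported on `[t, n)`. -/
def Matrix.VanishesBelow (s t : ℕ) (M : Matrix (Fin n) (Fin n) K) : Prop :=
  ∀ a b : Fin n, s ≤ a → (b : ℕ) < t → M a b = 0

/-- `M` is supported on the entries `(a, b)` with `s ≤ a` and `b < s`. -/
def Matrix.IsFlagShear (s : ℕ) (M : Matrix (Fin n) (Fin n) K) : Prop :=
  ∀ a b : Fin n, ¬ (s ≤ a ∧ (b : ℕ) < s) → M a b = 0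

/-- The lower right block of `M` starting at `s`, completed by an identity block. -/
def Matrix.lowerBlock {R : Type*} [CommRing R] (s : ℕ) (M : Matrix (Fin n) (Fin n) R) :
    Matrix (Fin n) (Fin n) R :=
  fun a b => if s ≤ a ∧ s ≤ b then M a b else (1 : Matrix (Fin n) (Fin n) R) a b

theorem Matrix.IsFlagShear.mul_self {s : ℕ} {M : Matrix (Fin n) (Fin n) K}
    (hM : M.IsFlagShear s) : M * M = 0 := by
  ext a b
  rw [Matrix.mul_apply]
  refine Finset.sum_eq_zero fun c _ => ?_
  by_cases hc : (c : ℕ) < s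
  · rw [hM c b (by omega), mul_zero]
  · rw [hM a c (by omega), zero_mul]

theorem Matrix.IsFlagShear.sub_mul_add {s : ℕ} {M : Matrix (Fin n) (Fin n) K}
    (hM : M.IsFlagShear s) : (1 - M) * (1 + M) = 1 := by
  have := hM.mul_self
  noncomm_ring
  simp [this]

theorem Matrix.IsFlagShear.add_mul_sub {s : ℕ} {M : Matrix (Fin n) (Fin n) K}
    (hM : M.IsFlagShear s) : (1 + M) * (1 - M) = 1 := by
  have := hM.mul_self
  noncomm_ring
  simp [this]

theorem prod_flag_conj_eq_zero (k : ℕ) (s : ℕ → ℕ) (h0 : s 0 = 0) (hk : s k = n)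
    (Y B : ℕ → Matrix (Fin n) (Fin n) K)
    (hY : ∀ j < k, (Y j).VanishesBelow (s j) (s (j + 1))) (hB : ∀ j, (B j).IsFlagShear (s j)) :
    ((List.range k).map fun j => (1 + B j) * Y j * (1 - B (j + 1))).prod = 0 := by
  -- After the change of basis `1 + B j`, the rows of the partial product lie in the j-th step of
  -- the flag; at `j = k` this step is zero.
  have key : ∀ j ≤ k, ∀ a b : Fin n, (b : ℕ) < s j →
      (((List.range j).map fun j => (1 + B j) * Y j * (1 - B (j + 1))).prod * (1 + B j)) a b
        = 0 := by
    intro j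
    induction j with
    | zero => intro _ a b hb; omega
    | succ j ih =>
      intro hj a b hb
      rw [List.range_succ, List.map_append, List.prod_append, List.map_singleton,
        List.prod_singleton, ← mul_assoc, ← mul_assoc, mul_assoc _ (1 - B (j + 1)),
        (hB (j + 1)).sub_mul_add, mul_one, Matrix.mul_apply]
      refine Finset.sum_eq_zero fun c _ => ?_
      by_cases hc : (c : ℕ) < s j
      · rw [ih (by omega) a c hc, zero_mul]
      · rw [hY j (by omega) c b (by omega) hb, mul_zero]
  have h1 : ((List.range k).map fun j => (1 + B j) * Y j * (1 - B (j + 1))).prod * (1 + B k)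
      = 0 := by
    ext a b
    exact key k le_rfl a b (by omega)
  have h2 := congrArg (· * (1 - B k)) h1
  simpa [mul_assoc, (hB k).add_mul_sub] using h2

theorem Matrix.mul_mem_subfield {F : Subfield K} {M N : Matrix (Fin n) (Fin n) K}
    (hM : ∀ i j, M i j ∈ F) (hN : ∀ i j, N i j ∈ F) (i j : Fin n) : (M * N) i j ∈ F := by
  rw [Matrix.mul_apply]
  exact sum_mem fun c _ => mul_mem (hM _ _) (hN _ _)

theorem Matrix.one_mem_subfield (F : Subfield K) (i j : Fin n) :
    (1 : Matrix (Fin n) (Fin n) K) i j ∈ F := by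
  rw [Matrix.one_apply]
  split_ifs
  exacts [F.one_mem, F.zero_mem]

/-- The flag shear and the block matrix are rational in the entries of the product. -/
theorem Matrix.mem_subfield_of_mul_one_sub (F : Subfield K) {s t : ℕ} (hst : s ≤ t)
    {Y B : Matrix (Fin n) (Fin n) K} (hY : Y.VanishesBelow s t) (hB : B.IsFlagShear t)
    (hdet : (Y.lowerBlock t).det ≠ 0) (h : ∀ a b, (Y * (1 - B)) a b ∈ F) :
    (∀ a b, B a b ∈ F) ∧ ∀ a b, Y a b ∈ F := by
  set Z := Y * (1 - B) with hZ
  have hZ' : ∀ a b, Z a b = Y a b - ∑ c, Y a c * B c b := fun a b => by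
    rw [hZ, mul_sub, mul_one, Matrix.sub_apply, Matrix.mul_apply]
  have hM : ∀ a b, Y.lowerBlock t a b ∈ F := fun a b => by
    unfold Matrix.lowerBlock
    split_ifs with hab
    · have : Z a b = Y a b := by
        rw [hZ', Finset.sum_eq_zero, sub_zero]
        intro c _
        rw [hB c b (by omega), mul_zero]
      exact this ▸ h a b
    · exact Matrix.one_mem_subfield F a b
  let N : Matrix (Fin n) (Fin n) K := fun a b => if t ≤ a ∧ (b : ℕ) < t then - Z a b else 0
  have hN : ∀ a b, N a b ∈ F := fun a b => by
    simp only [N]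
    split_ifs
    exacts [neg_mem (h a b), F.zero_mem]
  -- In the block of rows ≥ t and columns < t, `Y` vanishes, so `Z` is there minus the product of
  -- the lower right block of `Y` with `B`. This linear system determines `B`.
  have hMB : Y.lowerBlock t * B = N := by
    ext a b
    rw [Matrix.mul_apply]
    simp only [N]
    split_ifs with hab
    · rw [hZ', hY a b (by omega) hab.2, zero_sub, neg_neg]
      refine Finset.sum_congr rfl fun c _ => ?_
      by_cases hc : t ≤ c
      · simp [Matrix.lowerBlock, hab.1, hc]
      · rw [hB c b (by omega), mul_zero, mul_zero]
    · refine Finset.sum_eq_zero fun c _ => ?_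
      by_cases hc : t ≤ c ∧ (b : ℕ) < t
      · have hne : a ≠ c := by rintro rfl; exact hab hc
        have hat : ¬ (t ≤ a ∧ t ≤ c) := by omega
        simp [Matrix.lowerBlock, hat, Matrix.one_apply_ne hne]
      · rw [hB c b hc, mul_zero]
  have hBF : ∀ a b, B a b ∈ F := by
    have : B = (Y.lowerBlock t)⁻¹ * N := by
      rw [← hMB, ← mul_assoc, Matrix.nonsing_inv_mul _ (isUnit_iff_ne_zero.2 hdet), one_mul]
    rw [this]
    exact Matrix.mul_mem_subfield (Matrix.inv_mem_subfield F _ hM) hN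
  refine ⟨hBF, ?_⟩
  have : Y = Z * (1 + B) := by rw [hZ, mul_assoc, hB.sub_mul_add, mul_one]
  rw [this]
  exact Matrix.mul_mem_subfield h fun a b => add_mem (Matrix.one_mem_subfield F a b) (hBF a b)

/-- The parameters can be recovered from the tuple one index at a time: once `B j` is known it can
be removed on the left, and the product that remains determines `B (j + 1)` and `Y j`. The start is
`B 0 = 0`. -/
theorem mem_subfield_of_flag_conj (F : Subfield K) (k : ℕ) (s : ℕ → ℕ) (hs : Monotone s)
    (Y B : ℕ → Matrix (Fin n) (Fin n) K) (hB0 : B 0 = 0)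
    (hY : ∀ j < k, (Y j).VanishesBelow (s j) (s (j + 1))) (hB : ∀ j, (B j).IsFlagShear (s j))
    (hdet : ∀ j < k, ((Y j).lowerBlock (s (j + 1))).det ≠ 0)
    (h : ∀ j < k, ∀ a b, ((1 + B j) * Y j * (1 - B (j + 1))) a b ∈ F) :
    ∀ j < k, (∀ a b, B (j + 1) a b ∈ F) ∧ ∀ a b, Y j a b ∈ F := by
  have step : ∀ j < k, (∀ a b, B j a b ∈ F) →
      (∀ a b, B (j + 1) a b ∈ F) ∧ ∀ a b, Y j a b ∈ F := fun j hj hBj => by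
    refine Matrix.mem_subfield_of_mul_one_sub F (hs j.le_succ) (hY j hj) (hB _) (hdet j hj) ?_
    have : Y j * (1 - B (j + 1)) = (1 - B j) * ((1 + B j) * Y j * (1 - B (j + 1))) := by
      rw [← mul_assoc, ← mul_assoc, (hB j).sub_mul_add, one_mul]
    rw [this]
    exact Matrix.mul_mem_subfield
      (fun a b => sub_mem (Matrix.one_mem_subfield F a b) (hBj a b)) (h j hj)
  have hBF : ∀ j ≤ k, ∀ a b, B j a b ∈ F := by
    intro j
    induction j with
    | zero => intro _ a b; rw [hB0]; exact F.zero_mem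
    | succ j ih => intro hj; exact (step j (by omega) (ih (by omega))).1
  exact fun j hj => step j hj (hBF j hj.le)

end Flag

/-! ### Counting the parameters of the flag family -/

theorem sum_ite_le_and_lt (n s t : ℕ) (ht : t ≤ n) :
    ∑ a : Fin n, ∑ b : Fin n, (if s ≤ a ∧ (b : ℕ) < t then 1 else 0) = (n - s) * t := by
  have h1 : ∑ a : Fin n, (if s ≤ a then 1 else 0) = n - s := by
    rw [Fin.sum_univ_eq_sum_range (fun a => if s ≤ a then 1 else 0), ← Finset.card_filter]
    have : (Finset.range n).filter (fun a => s ≤ a) = Finset.Ico s n := by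
      ext; simp; omega
    simp [this]
  have h2 : ∑ b : Fin n, (if (b : ℕ) < t then 1 else 0) = t := by
    rw [Fin.sum_univ_eq_sum_range (fun b => if b < t then 1 else 0), ← Finset.card_filter]
    have : (Finset.range n).filter (fun b => b < t) = Finset.range t := by
      ext; simp; omega
    simp [this]
  calc _ = ∑ a : Fin n, ∑ b : Fin n,
        (if s ≤ a then 1 else 0) * (if (b : ℕ) < t then 1 else 0) := by
        simp only [ite_and, ite_mul, one_mul, zero_mul]
    _ = _ := by rw [← Finset.sum_mul_sum, h1, h2]

/-- The parameters of the family of `k`-tuples of `n × n` matrices which shift some flag whose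
dimensions are given by `s`: the entries of the block matrices, and those of the shears. -/
def IsFlagParam (k n : ℕ) (s : ℕ → ℕ) :
    (Fin k × Fin n × Fin n) ⊕ (Fin k × Fin n × Fin n) → Prop :=
  Sum.elim (fun t => ¬ (s t.1 ≤ t.2.1 ∧ (t.2.2 : ℕ) < s (t.1 + 1)))
    (fun t => s (t.1 + 1) ≤ t.2.1 ∧ (t.2.2 : ℕ) < s (t.1 + 1))

theorem card_isFlagParam (k n : ℕ) (s : ℕ → ℕ) (hs : ∀ j ≤ k, s j ≤ n)
    [Fintype {i // IsFlagParam k n s i}] :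
    Fintype.card {i // IsFlagParam k n s i} +
      ∑ j ∈ Finset.range k, (n - s j) * s (j + 1) =
    k * n ^ 2 + ∑ j ∈ Finset.range k, (n - s (j + 1)) * s (j + 1) := by
  classical
  have h1 : Fintype.card {i // IsFlagParam k n s i} =
      (∑ j : Fin k, ∑ a : Fin n, ∑ b : Fin n,
        if ¬ (s j ≤ a ∧ (b : ℕ) < s (j + 1)) then 1 else 0) +
      ∑ j : Fin k, ∑ a : Fin n, ∑ b : Fin n,
        if s (j + 1) ≤ a ∧ (b : ℕ) < s (j + 1) then 1 else 0 := by
    rw [Fintype.card_subtype, Finset.card_filter, Fintype.sum_sum_type, Fintype.sum_prod_type,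
      Fintype.sum_prod_type]
    simp only [Fintype.sum_prod_type]
    congr!
  rw [h1, ← Fin.sum_univ_eq_sum_range (fun j => (n - s j) * s (j + 1)),
    ← Fin.sum_univ_eq_sum_range (fun j => (n - s (j + 1)) * s (j + 1))]
  have h2 : ∀ j : Fin k, (∑ a : Fin n, ∑ b : Fin n,
      (if ¬ (s j ≤ a ∧ (b : ℕ) < s (j + 1)) then 1 else 0)) + (n - s j) * s (j + 1) = n ^ 2 := by
    intro j
    rw [← sum_ite_le_and_lt n (s j) (s (j + 1)) (hs _ j.2), ← Finset.sum_add_distrib]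
    simp only [← Finset.sum_add_distrib]
    rw [Finset.sum_congr rfl fun a _ => Finset.sum_congr rfl fun b _ =>
      (show _ = 1 by split_ifs <;> rfl)]
    simp [pow_two]
  have h3 : ∀ j : Fin k, (∑ a : Fin n, ∑ b : Fin n,
      (if (s (j + 1) ≤ a ∧ (b : ℕ) < s (j + 1)) then 1 else 0)) =
        (n - s (j + 1)) * s (j + 1) := fun j => sum_ite_le_and_lt n _ _ (hs _ j.2)
  rw [Finset.sum_congr rfl fun j _ => h3 j, add_right_comm, ← Finset.sum_add_distrib,
    Finset.sum_congr rfl fun j _ => h2 j]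
  simp

/-- The elements of a field algebraic over a subalgebra form a subfield. -/
def Subalgebra.algebraicSubfield {F K : Type*} [Field F] [Field K] [Algebra F K]
    (A : Subalgebra F K) : Subfield K :=
  { (Subalgebra.algebraicClosure A K).toSubring with
    inv_mem' := fun _ hx => IsAlgebraic.inv hx }

theorem Subalgebra.mem_algebraicSubfield {F K : Type*} [Field F] [Field K] [Algebra F K]
    {A : Subalgebra F K} {x : K} : x ∈ A.algebraicSubfield ↔ IsAlgebraic A x := Iff.rfl

theorem subfield_eq_top_of_X_mem {F τ : Type*} [Field F]
    (S : Subfield (FractionRing (MvPolynomial τ F)))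
    (hF : ∀ c : F, algebraMap F _ c ∈ S)
    (hX : ∀ t, algebraMap (MvPolynomial τ F) _ (MvPolynomial.X t) ∈ S)
    (z : FractionRing (MvPolynomial τ F)) : z ∈ S := by
  have hp : ∀ p : MvPolynomial τ F, algebraMap _ (FractionRing (MvPolynomial τ F)) p ∈ S := by
    intro p
    induction p using MvPolynomial.induction_on with
    | C a => exact hF a
    | add p q hp hq => rw [map_add]; exact add_mem hp hq
    | mul_X p t hp => rw [map_mul]; exact mul_mem hp (hX t)
  obtain ⟨p, q, _, rfl⟩ := IsFractionRing.div_surjective (A := MvPolynomial τ F) z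
  exact div_mem (hp p) (hp q)

theorem List.prod_map_smul_const {R M ι : Type*} [CommSemiring R] [Semiring M] [Algebra R M]
    (c : R) (l : List ι) (f : ι → M) :
    (l.map fun i => c • f i).prod = c ^ l.length • (l.map f).prod := by
  induction l with
  | nil => simp
  | cons a l ih =>
    rw [List.map_cons, List.prod_cons, ih, List.map_cons, List.prod_cons, List.length_cons,
      smul_mul_smul_comm, pow_succ']

/-! ### The generic point and the dimension bound -/

/-- The generic `k`-tuple of `n × n` matrices. -/
noncomputable def genericTuple (F : Type*) [CommRing F] (k n : ℕ) (j : ℕ) :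
    Matrix (Fin n) (Fin n) (MvPolynomial (Fin k × Fin n × Fin n) F) :=
  fun a b => if h : j < k then MvPolynomial.X (⟨j, h⟩, a, b) else 0

theorem aeval_prod_genericTuple {F K : Type*} [CommRing F] [CommRing K] [Algebra F K]
    (k n : ℕ) (M : ℕ → Matrix (Fin n) (Fin n) K) (a b : Fin n) :
    MvPolynomial.aeval (fun t : Fin k × Fin n × Fin n => M t.1 t.2.1 t.2.2)
      (((List.range k).map (genericTuple F k n)).prod a b) = ((List.range k).map M).prod a b := by
  let φ := (MvPolynomial.aeval (R := F)
    (fun t : Fin k × Fin n × Fin n => M t.1 t.2.1 t.2.2)).toRingHom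
  have h : φ.mapMatrix (((List.range k).map (genericTuple F k n)).prod) =
      ((List.range k).map M).prod := by
    rw [map_list_prod, List.map_map]
    congr 1
    refine List.map_congr_left fun j hj => ?_
    rw [List.mem_range] at hj
    ext a b
    simp [genericTuple, hj, φ]
  exact congrFun (congrFun h a) b

/-- The polynomial of a linear form. -/
noncomputable def LinearMap.toMvPoly {F σ : Type*} [Field F] [Fintype σ] [DecidableEq σ]
    (f : (σ → F) →ₗ[F] F) : MvPolynomial σ F :=
  ∑ i, MvPolynomial.C (f (Pi.single i 1)) * MvPolynomial.X i

theorem LinearMap.aeval_toMvPoly {F σ : Type*} [Field F] [Fintype σ] [DecidableEq σ]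
    (f : (σ → F) →ₗ[F] F) (z : σ → F) : MvPolynomial.aeval z f.toMvPoly = f z := by
  rw [LinearMap.toMvPoly, map_sum, LinearMap.pi_apply_eq_sum_univ f z]
  refine Finset.sum_congr rfl fun i _ => ?_
  simp only [map_mul, MvPolynomial.aeval_C, MvPolynomial.aeval_X, smul_eq_mul, mul_comm (z i),
    Algebra.algebraMap_self, RingHom.id_apply]
  congr 2
  ext j
  simp [Pi.single_apply, eq_comm]

theorem LinearMap.aeval_smul_toMvPoly {F K σ : Type*} [Field F] [Field K] [Algebra F K]
    [Fintype σ] [DecidableEq σ] (f : (σ → F) →ₗ[F] F) (c : K) (x : σ → K) :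
    MvPolynomial.aeval (c • x) f.toMvPoly = c * MvPolynomial.aeval x f.toMvPoly := by
  simp only [LinearMap.toMvPoly, map_sum, map_mul, MvPolynomial.aeval_C, MvPolynomial.aeval_X,
    Pi.smul_apply, smul_eq_mul, Finset.mul_sum]
  exact Finset.sum_congr rfl fun i _ => by ring

/-- The generic block matrices of the flag-shifting family. -/
noncomputable def flagBlock (F : Type*) [Field F] (k n : ℕ) (s : ℕ → ℕ) (j : ℕ) :
    Matrix (Fin n) (Fin n) (MvPolynomial {i // IsFlagParam k n s i} F) :=
  open Classical in fun a b => if h : ∃ hj : j < k, IsFlagParam k n s (Sum.inl (⟨j, hj⟩, a, b))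
    then MvPolynomial.X ⟨_, h.2⟩ else 0

/-- The generic shears of the flag-shifting family. -/
noncomputable def flagShear (F : Type*) [Field F] (k n : ℕ) (s : ℕ → ℕ) :
    ℕ → Matrix (Fin n) (Fin n) (MvPolynomial {i // IsFlagParam k n s i} F)
  | 0 => 0
  | j + 1 => open Classical in fun a b =>
    if h : ∃ hj : j < k, IsFlagParam k n s (Sum.inr (⟨j, hj⟩, a, b))
    then MvPolynomial.X ⟨_, h.2⟩ else 0

theorem det_lowerBlock_flagBlock_ne_zero (F : Type*) [Field F] (k n : ℕ) (s : ℕ → ℕ) (j : ℕ)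
    (hj : j < k) : ((flagBlock F k n s j).lowerBlock (s (j + 1))).det ≠ 0 := by
  -- Specializing every block to the identity matrix, where permitted, makes the lower block the
  -- identity.
  let e : {i // IsFlagParam k n s i} → F := fun t =>
    Sum.elim (fun t => (1 : Matrix (Fin n) (Fin n) F) t.2.1 t.2.2) (fun _ => 0) t.1
  intro h0
  have h1 : (MvPolynomial.eval e).mapMatrix ((flagBlock F k n s j).lowerBlock (s (j + 1))) = 1 := by
    ext a b
    simp only [RingHom.mapMatrix_apply, Matrix.map_apply, Matrix.lowerBlock]
    split_ifs with hab
    · have : ∃ hj : j < k, IsFlagParam k n s (Sum.inl (⟨j, hj⟩, a, b)) :=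
        ⟨hj, by simp only [IsFlagParam, Sum.elim_inl]; omega⟩
      simp only [flagBlock, this, dif_pos, MvPolynomial.eval_X]
      rfl
    · simp only [Matrix.one_apply]
      split_ifs <;> simp
  have h2 := congrArg (MvPolynomial.eval e) h0
  rw [RingHom.map_det, h1, Matrix.det_one, map_zero] at h2
  exact one_ne_zero h2

/-- The image of `y ↦ (X j y)` is cut out by `k * n ^ 2 - m` linear forms and meets the cone of zero
products only at 0. These forms, evaluated at the generic point of the flag family, must therefore
be at least as many as its parameters. -/
theorem le_of_prod_eq_zero_imp {F : Type} [Field F] [IsAlgClosed F] (k n m : ℕ) (hk : 0 < k)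
    (s : ℕ → ℕ) (hs : Monotone s) (h0 : s 0 = 0) (hsk : s k = n)
    (X : ℕ → (Fin m → F) →ₗ[F] Matrix (Fin n) (Fin n) F)
    (h : ∀ y, ((List.range k).map fun j => X j y).prod = 0 → y = 0) :
    m + ∑ j ∈ Finset.range k, (n - s (j + 1)) * s (j + 1) ≤
      ∑ j ∈ Finset.range k, (n - s j) * s (j + 1) := by
  classical
  let σ := Fin k × Fin n × Fin n
  let L : (Fin m → F) →ₗ[F] (σ → F) := LinearMap.pi fun t =>
    (Matrix.entryLinearMap F F t.2.1 t.2.2).comp (X t.1)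
  have hL : ∀ y t, L y t = X t.1 y t.2.1 t.2.2 := fun _ _ => rfl
  have hLinj : Function.Injective L := by
    rw [injective_iff_map_eq_zero]
    intro y hy
    apply h
    apply List.prod_eq_zero
    rw [List.mem_map]
    refine ⟨0, List.mem_range.2 hk, ?_⟩
    ext a b
    have := congrFun hy (⟨0, hk⟩, a, b)
    rwa [hL] at this
  let Q := (σ → F) ⧸ LinearMap.range L
  have hfin : Module.finrank F Q + m = k * n ^ 2 := by
    have h1 := Submodule.finrank_quotient_add_finrank (LinearMap.range L)
    rw [LinearMap.finrank_range_of_inj hLinj] at h1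
    simpa [σ, pow_two] using h1
  let bQ := Module.finBasis F Q
  let f : Fin (Module.finrank F Q) → (σ → F) →ₗ[F] F := fun i =>
    (bQ.coord i).comp (LinearMap.range L).mkQ
  have hf : ∀ z, (∀ i, f i z = 0) → z ∈ LinearMap.range L := fun z hz => by
    rw [← Submodule.Quotient.mk_eq_zero, ← bQ.forall_coord_eq_zero_iff]
    exact hz
  let R := MvPolynomial {i // IsFlagParam k n s i} F
  let K := FractionRing R
  let ψ : R →+* K := algebraMap R K
  have hψ : Function.Injective ψ := IsFractionRing.injective R K
  let Y : ℕ → Matrix (Fin n) (Fin n) K := fun j => ψ.mapMatrix (flagBlock F k n s j)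
  let B : ℕ → Matrix (Fin n) (Fin n) K := fun j => ψ.mapMatrix (flagShear F k n s j)
  have hB0 : B 0 = 0 := by simp only [B, flagShear, map_zero]
  have hY : ∀ j < k, (Y j).VanishesBelow (s j) (s (j + 1)) := by
    intro j hj a b ha hb
    have : ¬ ∃ hj : j < k, IsFlagParam k n s (Sum.inl (⟨j, hj⟩, a, b)) := by
      rintro ⟨_, h⟩
      exact h ⟨ha, hb⟩
    simp only [Y, RingHom.mapMatrix_apply, Matrix.map_apply, flagBlock, this, dif_neg,
      not_false_eq_true, map_zero]
  have hB : ∀ j, (B j).IsFlagShear (s j) := by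
    intro j a b hab
    cases j with
    | zero => rw [hB0]; rfl
    | succ j =>
      have : ¬ ∃ hj : j < k, IsFlagParam k n s (Sum.inr (⟨j, hj⟩, a, b)) := by
        rintro ⟨_, h⟩
        exact hab h
      simp only [B, RingHom.mapMatrix_apply, Matrix.map_apply, flagShear, this, dif_neg,
        not_false_eq_true, map_zero]
  have hdet : ∀ j < k, ((Y j).lowerBlock (s (j + 1))).det ≠ 0 := by
    intro j hj
    have : (Y j).lowerBlock (s (j + 1)) =
        ψ.mapMatrix ((flagBlock F k n s j).lowerBlock (s (j + 1))) := by
      ext a b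
      simp only [Y, RingHom.mapMatrix_apply, Matrix.map_apply, Matrix.lowerBlock]
      split_ifs
      · rfl
      · simp only [Matrix.one_apply]
        split_ifs <;> simp
    rw [this, ← RingHom.map_det]
    exact fun h => det_lowerBlock_flagBlock_ne_zero F k n s j hj (hψ (by rw [h, map_zero]))
  let M : ℕ → Matrix (Fin n) (Fin n) K := fun j => (1 + B j) * Y j * (1 - B (j + 1))
  have hM : ((List.range k).map M).prod = 0 := prod_flag_conj_eq_zero k s h0 hsk Y B hY hB
  let x : σ → K := fun t => M t.1 t.2.1 t.2.2
  let A := Algebra.adjoin F (Set.range fun i => MvPolynomial.aeval x (f i).toMvPoly)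
  have hint : ∀ t, IsIntegral A (x t) := by
    refine isIntegral_coord_of_forall_eq_zero
      (fun e : Fin n × Fin n => ((List.range k).map (genericTuple F k n)).prod e.1 e.2)
      (fun i => (f i).toMvPoly) x (fun c i => (f i).aeval_smul_toMvPoly c x) ?_ ?_
    -- The zero product condition is homogeneous, so every multiple of the generic point satisfies
    -- it.
    · rintro c ⟨a, b⟩
      have := aeval_prod_genericTuple (F := F) k n (fun j => c • M j) a b
      rw [List.prod_map_smul_const, hM, smul_zero] at this
      exact this
    · intro z hz hz'
      obtain ⟨y, rfl⟩ := hf z fun i => by rw [← LinearMap.aeval_toMvPoly]; exact hz' i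
      have : y = 0 := h y <| by
        ext a b
        rw [← aeval_prod_genericTuple (F := F) k n (fun j => X j y) a b]
        exact hz (a, b)
      rw [this, map_zero]
  have hmem := mem_subfield_of_flag_conj A.algebraicSubfield k s hs Y B hB0 hY hB hdet
    fun j hj a b => Subalgebra.mem_algebraicSubfield.2 (hint (⟨j, hj⟩, a, b)).isAlgebraic
  have halg : Algebra.IsAlgebraic A K := ⟨fun z => by
    refine Subalgebra.mem_algebraicSubfield.1 (subfield_eq_top_of_X_mem _ ?_ ?_ z)
    · intro c
      exact Subalgebra.mem_algebraicSubfield.2 (isAlgebraic_algebraMap (algebraMap F A c))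
    · rintro ⟨⟨j, a, b⟩ | ⟨j, a, b⟩, hp⟩
      · have h1 := (hmem j j.2).2 a b
        have h2 : ∃ hj : (j : ℕ) < k, IsFlagParam k n s (Sum.inl (⟨j, hj⟩, a, b)) := ⟨j.2, hp⟩
        simp only [Y, RingHom.mapMatrix_apply, Matrix.map_apply, flagBlock, h2, dif_pos] at h1
        exact h1
      · have h1 := (hmem j j.2).1 a b
        have h2 : ∃ hj : (j : ℕ) < k, IsFlagParam k n s (Sum.inr (⟨j, hj⟩, a, b)) := ⟨j.2, hp⟩
        simp only [B, RingHom.mapMatrix_apply, Matrix.map_apply, flagShear, h2, dif_pos] at h1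
        exact h1⟩
  have hind : AlgebraicIndependent F fun t : {i // IsFlagParam k n s i} =>
      ψ (MvPolynomial.X t) :=
    (MvPolynomial.algebraicIndependent_X _ F).map' (f := Algebra.algHom F R K) hψ
  have hcard := card_le_card_of_isAlgebraic_adjoin _ hind _ halg
  rw [Fintype.card_fin] at hcard
  have hcount := card_isFlagParam k n s fun j hj => hsk ▸ hs hj
  omega

/-! ### Coordinates of the matrix multiplication tensor -/

/-- The standard basis vectors of the factors of the matrix multiplication tensor. -/
noncomputable def maMuBasis (k n : ℕ) (j : Fin (k + 1)) (a b : Fin n) :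
    MaMuSpace (fun _ : Fin (k + 1) => n) j :=
  Fin.cases (motive := MaMuSpace (fun _ : Fin (k + 1) => n))
    (Matrix.single a b (1 : ℂ))
    (fun _ : Fin k => (Matrix.stdBasis ℂ (Fin n) (Fin n)).coord (a, b)) j

/-- The first index of the `j`-th factor of the summand indexed by `i`. -/
def maMuRow {k n : ℕ} (i : Fin (k + 1) → Fin n) : Fin (k + 1) → Fin n :=
  Fin.cases (i 0) fun j : Fin k => i j.castSucc

/-- The second index of the `j`-th factor of the summand indexed by `i`. -/
def maMuCol {k n : ℕ} (i : Fin (k + 1) → Fin n) : Fin (k + 1) → Fin n :=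
  Fin.cases (i (Fin.last k)) fun j : Fin k => i j.succ

theorem MaMu_eq_sum_maMuBasis (k n : ℕ) : MaMu (fun _ : Fin (k + 1) => n) =
    ∑ i : Fin (k + 1) → Fin n, PiTensorProduct.tprod ℂ
      fun j => maMuBasis k n j (maMuRow i j) (maMuCol i j) := by
  unfold MaMu
  refine Finset.sum_congr rfl fun i _ => ?_
  congr 1
  funext j
  refine Fin.cases ?_ (fun j => ?_) j <;> rfl

theorem map_MaMu {k n : ℕ} {W : Type*} [AddCommGroup W] [Module ℂ W]
    (A : ∀ j, MaMuSpace (fun _ : Fin (k + 1) => n) j →ₗ[ℂ] W) :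
    PiTensorProduct.map A (MaMu fun _ : Fin (k + 1) => n) =
    ∑ i : Fin (k + 1) → Fin n, PiTensorProduct.tprod ℂ
      fun j => A j (maMuBasis k n j (maMuRow i j) (maMuCol i j)) := by
  rw [MaMu_eq_sum_maMuBasis, map_sum]
  simp only [PiTensorProduct.map_tprod]

theorem exists_linearMap_maMuBasis {k n : ℕ} {W : Type*} [AddCommGroup W] [Module ℂ W]
    (w : Fin (k + 1) → Fin n → Fin n → W) :
    ∃ A : ∀ j, MaMuSpace (fun _ : Fin (k + 1) => n) j →ₗ[ℂ] W,
      ∀ j a b, A j (maMuBasis k n j a b) = w j a b := by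
  suffices ∀ j, ∃ A : MaMuSpace (fun _ : Fin (k + 1) => n) j →ₗ[ℂ] W,
      ∀ a b, A (maMuBasis k n j a b) = w j a b by
    choose A hA using this
    exact ⟨A, hA⟩
  refine Fin.cases ?_ fun j => ?_
  · refine ⟨(Matrix.stdBasis ℂ (Fin n) (Fin n)).constr ℂ fun p => w 0 p.1 p.2, fun a b => ?_⟩
    have := (Matrix.stdBasis ℂ (Fin n) (Fin n)).constr_basis ℂ
      (fun p => w 0 p.1 p.2) (a, b)
    rwa [Matrix.stdBasis_eq_single] at this
  · refine ⟨(Matrix.stdBasis ℂ (Fin n) (Fin n)).dualBasis.constr ℂ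
      fun p => w j.succ p.1 p.2, fun a b => ?_⟩
    have := (Matrix.stdBasis ℂ (Fin n) (Fin n)).dualBasis.constr_basis ℂ
      (fun p => w j.succ p.1 p.2) (a, b)
    rwa [Module.Basis.coe_dualBasis] at this

theorem sum_prod_eq_sum_mul_list_prod {R : Type*} [CommRing R] {n : ℕ} (k : ℕ)
    (M : ℕ → Matrix (Fin n) (Fin n) R) (g : Fin n → Fin n → R) :
    ∑ i : Fin (k + 1) → Fin n, g (i 0) (i (Fin.last k)) *
      ∏ j : Fin k, M j (i j.castSucc) (i j.succ) =
    ∑ a, ∑ b, g a b * ((List.range k).map M).prod a b := by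
  induction k generalizing g with
  | zero =>
    rw [← (Equiv.funUnique (Fin 1) (Fin n)).symm.sum_comp]
    refine Finset.sum_congr rfl fun a _ => ?_
    simp [Matrix.one_apply]
  | succ k ih =>
    rw [← (Fin.snocEquiv fun _ : Fin (k + 1 + 1) => Fin n).sum_comp, Fintype.sum_prod_type_right]
    have h1 : ∀ (i : Fin (k + 1) → Fin n),
        ∑ b : Fin n, g ((Fin.snocEquiv fun _ : Fin (k + 1 + 1) => Fin n) (b, i) 0)
          ((Fin.snocEquiv fun _ : Fin (k + 1 + 1) => Fin n) (b, i) (Fin.last (k + 1))) *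
          ∏ j : Fin (k + 1), M j
            ((Fin.snocEquiv fun _ : Fin (k + 1 + 1) => Fin n) (b, i) j.castSucc)
            ((Fin.snocEquiv fun _ : Fin (k + 1 + 1) => Fin n) (b, i) j.succ) =
        (∑ b, g (i 0) b * M k (i (Fin.last k)) b) *
          ∏ j : Fin k, M j (i j.castSucc) (i j.succ) := by
      intro i
      rw [Finset.sum_mul]
      refine Finset.sum_congr rfl fun b _ => ?_
      have h0 : (Fin.snoc i b : Fin (k + 1 + 1) → Fin n) 0 = i 0 :=
        Fin.snoc_castSucc (α := fun _ => Fin n) b i 0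
      rw [Fin.prod_univ_castSucc]
      simp only [Fin.snocEquiv_apply, Fin.snoc_last, Fin.snoc_castSucc, Fin.succ_last,
        Fin.val_last, Fin.val_castSucc, ← Fin.castSucc_succ, h0]
      ring
    rw [Finset.sum_congr rfl fun i _ => h1 i, ih fun a c => ∑ b, g a b * M k c b]
    refine Finset.sum_congr rfl fun a _ => ?_
    rw [List.range_succ, List.map_append, List.prod_append, List.map_singleton,
      List.prod_singleton]
    simp only [Matrix.mul_apply, Finset.sum_mul, Finset.mul_sum]
    rw [Finset.sum_comm]
    exact Finset.sum_congr rfl fun b _ => Finset.sum_congr rfl fun c _ => by ring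

/-! ### From a degeneration to a linear family of matrices -/

section Contraction

variable {k m : ℕ}

/-- The coordinate of a tensor at a multi-index. -/
noncomputable def tensorCoord (c : Fin (k + 1) → Fin m) :
    (⨂[ℂ] _ : Fin (k + 1), (Fin m → ℂ)) →ₗ[ℂ] ℂ :=
  PiTensorProduct.lift ((MultilinearMap.mkPiAlgebra ℂ (Fin (k + 1)) ℂ).compLinearMap
    fun j => LinearMap.proj (c j))

theorem tensorCoord_tprod (c : Fin (k + 1) → Fin m) (v : Fin (k + 1) → Fin m → ℂ) :
    tensorCoord c (PiTensorProduct.tprod ℂ v) = ∏ j, v j (c j) := by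
  simp [tensorCoord]

/-- The `l`-th coordinate of the contraction of all factors but the first with `y`. -/
noncomputable def tensorContract (y : Fin m → ℂ) (l : Fin m) :
    (⨂[ℂ] _ : Fin (k + 1), (Fin m → ℂ)) →ₗ[ℂ] ℂ :=
  ∑ c : Fin k → Fin m, (∏ j, y (c j)) • tensorCoord (Fin.cons l c)

theorem tensorContract_tprod (y : Fin m → ℂ) (l : Fin m) (v : Fin (k + 1) → Fin m → ℂ) :
    tensorContract y l (PiTensorProduct.tprod ℂ v) = v 0 l * ∏ j : Fin k, y ⬝ᵥ v j.succ := by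
  simp only [tensorContract, LinearMap.sum_apply, LinearMap.smul_apply, tensorCoord_tprod,
    smul_eq_mul, dotProduct, Fin.prod_univ_succ, Fin.cons_zero, Fin.cons_succ]
  rw [Finset.prod_univ_sum, Finset.mul_sum, Fintype.piFinset_univ]
  refine Finset.sum_congr rfl fun c _ => ?_
  rw [Finset.prod_mul_distrib]
  ring

theorem tensorContract_unitTensor (y : Fin m → ℂ) (l : Fin m) :
    tensorContract y l (unitTensor (Fin (k + 1)) m) = y l ^ k := by
  rw [unitTensor, map_sum]
  simp only [tensorContract_tprod, dotProduct_single, mul_one, Finset.prod_const,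
    Finset.card_univ, Fintype.card_fin]
  simp [Pi.single_apply]

/-- The tensors whose contraction vanishes at some point of the unit sphere form a closed set,
because projection along a compact space is closed. The unit tensor is outside it, so not every
restriction of `T` can be inside. -/
theorem exists_forall_tensorContract_ne_zero {V : Fin (k + 1) → Type*}
    [∀ j, AddCommGroup (V j)] [∀ j, Module ℂ (V j)] (T : ⨂[ℂ] j, V j)
    (h : DegeneratesTo T (unitTensor (Fin (k + 1)) m)) :
    ∃ A : ∀ j, V j →ₗ[ℂ] (Fin m → ℂ), ∀ y : Fin m → ℂ, ‖y‖ = 1 →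
      ∃ l, tensorContract y l (PiTensorProduct.map A T) ≠ 0 := by
  by_contra hcon
  push Not at hcon
  let W := ⨂[ℂ] _ : Fin (k + 1), (Fin m → ℂ)
  let : TopologicalSpace W := moduleTopology ℂ W
  have : IsModuleTopology ℂ W := ⟨rfl⟩
  let S := Metric.sphere (0 : Fin m → ℂ) 1
  have hcont : ∀ l, Continuous fun p : S × W => tensorContract p.1.1 l p.2 := fun l => by
    simp only [tensorContract, LinearMap.sum_apply, LinearMap.smul_apply, smul_eq_mul]
    refine continuous_finsetSum _ fun c _ => Continuous.mul ?_ ?_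
    · exact continuous_finsetProd _ fun j _ => (continuous_apply (c j)).comp
        (continuous_subtype_val.comp continuous_fst)
    · exact (IsModuleTopology.continuous_of_linearMap (tensorCoord (Fin.cons l c))).comp
        continuous_snd
  let C : Set (S × W) := {p | ∀ l, tensorContract p.1.1 l p.2 = 0}
  have hC : IsClosed C := by
    have : C = ⋂ l, {p | tensorContract p.1.1 l p.2 = 0} := by ext; simp [C]
    rw [this]
    exact isClosed_iInter fun l => isClosed_singleton.preimage (hcont l)
  have hS : CompactSpace S := isCompact_iff_compactSpace.1 (isCompact_sphere 0 1)
  have hcl : IsClosed (Prod.snd '' C) := isClosedMap_snd_of_compactSpace _ hC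
  have hsub : Set.range (fun A : ∀ j, V j →ₗ[ℂ] (Fin m → ℂ) => PiTensorProduct.map A T) ⊆
      Prod.snd '' C := by
    rintro _ ⟨A, rfl⟩
    obtain ⟨y, hy, hA⟩ := hcon A
    exact ⟨(⟨y, by simpa [S] using hy⟩, _), hA, rfl⟩
  obtain ⟨⟨⟨y, hy⟩, T'⟩, hC', rfl⟩ := closure_minimal hsub hcl h
  have hy0 : y = 0 := by
    funext l
    have := hC' l
    simp only [tensorContract_unitTensor] at this
    exact eq_zero_of_pow_eq_zero this
  simp [S, hy0] at hy

end Contraction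

theorem exists_linear_family_of_degeneratesTo {k n m : ℕ}
    (h : DegeneratesTo (MaMu fun _ : Fin (k + 1) => n) (unitTensor (Fin (k + 1)) m)) :
    ∃ X : ℕ → (Fin m → ℂ) →ₗ[ℂ] Matrix (Fin n) (Fin n) ℂ,
      ∀ y, ((List.range k).map fun j => X j y).prod = 0 → y = 0 := by
  obtain ⟨A, hA⟩ := exists_forall_tensorContract_ne_zero _ h
  let w : Fin (k + 1) → Fin n → Fin n → Fin m → ℂ := fun j a b => A j (maMuBasis k n j a b)
  let X : ℕ → (Fin m → ℂ) →ₗ[ℂ] Matrix (Fin n) (Fin n) ℂ := fun j =>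
    -- `Fin.ofNat` reduces modulo `k + 1`; only `j < k` matters, where this is `j.succ`.
    { toFun := fun y a b => y ⬝ᵥ w (Fin.ofNat (k + 1) (j + 1)) a b
      map_add' := fun y z => by ext a b; exact add_dotProduct _ _ _
      map_smul' := fun c y => by ext a b; exact smul_dotProduct _ _ _ }
  have hX : ∀ (j : Fin k) y a b, X j y a b = y ⬝ᵥ w j.succ a b := fun j y a b => by
    have : Fin.ofNat (k + 1) ((j : ℕ) + 1) = j.succ := by
      ext; simp [Nat.mod_eq_of_lt]
    rw [← this]
    rfl
  have hcon : ∀ y l, tensorContract y l (PiTensorProduct.map A (MaMu fun _ : Fin (k + 1) => n)) =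
      ∑ a, ∑ b, w 0 a b l * ((List.range k).map fun j => X j y).prod a b := fun y l => by
    rw [map_MaMu, map_sum, ← sum_prod_eq_sum_mul_list_prod k (fun j => X j y) fun a b => w 0 a b l]
    refine Finset.sum_congr rfl fun i _ => ?_
    rw [tensorContract_tprod]
    simp only [hX]
    rfl
  refine ⟨X, fun y hy => ?_⟩
  by_contra hy0
  have hn : ‖y‖ ≠ 0 := norm_ne_zero_iff.2 hy0
  obtain ⟨l, hl⟩ := hA (((‖y‖ : ℂ))⁻¹ • y) (by
    rw [norm_smul, norm_inv, Complex.norm_real, norm_norm, inv_mul_cancel₀ hn])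
  apply hl
  rw [hcon]
  simp only [map_smul]
  rw [List.prod_map_smul_const, hy]
  simp

/-! ### The balanced flag and the upper bound -/

/-- Since 2 (s' - s) s' = s'² - s² + (s' - s)², the sum telescopes up to the squares of the jumps,
of which `min K r` equal (q + 1)² and the others q². -/
theorem two_mul_sum_balanced (q r K : ℕ) :
    2 * ∑ j ∈ Finset.range K, ((((j + 1) * q + min (j + 1) r : ℕ) : ℤ) - (j * q + min j r : ℕ)) *
      ((j + 1) * q + min (j + 1) r : ℕ) =
    ((K * q + min K r : ℕ) : ℤ) ^ 2 + K * q ^ 2 + (2 * q + 1) * (min K r : ℕ) := by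
  induction K with
  | zero => simp
  | succ K ih =>
    rw [Finset.sum_range_succ, mul_add, ih]
    rcases lt_or_ge K r with h | h
    · rw [min_eq_left h.le, min_eq_left (show K + 1 ≤ r from h)]
      push_cast
      ring
    · rw [min_eq_right h, min_eq_right (show r ≤ K + 1 by omega)]
      push_cast
      ring

theorem two_mul_le_of_degeneratesTo {k n m q r : ℕ} (hk : 0 < k) (hq : q = n / k)
    (hr : r = n - q * k)
    (h : DegeneratesTo (MaMu fun _ : Fin (k + 1) => n) (unitTensor (Fin (k + 1)) m)) :
    2 * m ≤ n ^ 2 + n * q + r * (q + 1) := by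
  obtain ⟨X, hX⟩ := exists_linear_family_of_degeneratesTo h
  have hqk : q * k ≤ n := hq ▸ Nat.div_mul_le_self n k
  have hn : n = k * q + r := by rw [mul_comm k q]; omega
  have hrk : r < k := by
    have h1 := Nat.mod_lt n hk
    have h2 := Nat.div_add_mod n k
    rw [← hq] at h2
    omega
  let s : ℕ → ℕ := fun j => j * q + min j r
  have hmono : Monotone s := fun i j hij => add_le_add (Nat.mul_le_mul_right q hij)
    (min_le_min_right r hij)
  have hsk : s k = n := by simp only [s, min_eq_right hrk.le, hn]
  have hmain := le_of_prod_eq_zero_imp k n m hk s hmono (by simp [s]) hsk X hX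
  have hsn : ∀ j ≤ k, s j ≤ n := fun j hj => hsk ▸ hmono hj
  have hcast : (m : ℤ) ≤ ∑ j ∈ Finset.range k, ((s (j + 1) : ℤ) - s j) * s (j + 1) := by
    have h1 : (m : ℤ) + ∑ j ∈ Finset.range k, ((n : ℤ) - s (j + 1)) * s (j + 1) ≤
        ∑ j ∈ Finset.range k, ((n : ℤ) - s j) * s (j + 1) := by
      have h2 : ((m + ∑ j ∈ Finset.range k, (n - s (j + 1)) * s (j + 1) : ℕ) : ℤ) ≤
        ((∑ j ∈ Finset.range k, (n - s j) * s (j + 1) : ℕ) : ℤ) := by exact_mod_cast hmain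
      rw [Nat.cast_add, Nat.cast_sum, Nat.cast_sum] at h2
      convert h2 using 2
      · refine Finset.sum_congr rfl fun j hj => ?_
        rw [Nat.cast_mul, Nat.cast_sub (hsn _ (Finset.mem_range.1 hj))]
      · rw [Nat.cast_mul, Nat.cast_sub (hsn _ (Finset.mem_range.1 ‹_›).le)]
    rw [← le_sub_iff_add_le, ← Finset.sum_sub_distrib] at h1
    refine h1.trans (le_of_eq (Finset.sum_congr rfl fun j _ => by ring))
  have hbal := two_mul_sum_balanced q r k
  rw [min_eq_right hrk.le, ← hn] at hbal
  have h3 : 2 * (m : ℤ) ≤ (n : ℤ) ^ 2 + k * q ^ 2 + (2 * q + 1) * r := by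
    rw [← hbal]
    exact mul_le_mul_of_nonneg_left hcast (by norm_num)
  have h4 : (n : ℤ) = k * q + r := by exact_mod_cast hn
  zify
  calc 2 * (m : ℤ) ≤ (n : ℤ) ^ 2 + k * q ^ 2 + (2 * q + 1) * r := h3
    _ = (n : ℤ) ^ 2 + (k * q + r) * q + r * (q + 1) := by ring
    _ = _ := by rw [← h4]

/-! ### Monomial degenerations -/

theorem prod_zpow_eq_zpow_sum {G ι : Type*} [CommGroupWithZero G] {t : G} (ht : t ≠ 0)
    (s : Finset ι) (f : ι → ℤ) : ∏ i ∈ s, t ^ f i = t ^ ∑ i ∈ s, f i := by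
  classical
  induction s using Finset.induction_on with
  | empty => simp
  | insert a s ha ih => rw [Finset.prod_insert ha, Finset.sum_insert ha, ih, zpow_add₀ ht]

/-- Monomial degeneration of the matrix multiplication tensor to a unit tensor. -/
theorem degeneratesTo_unitTensor_of_weights {k n : ℕ} (Φ : Finset (Fin (k + 1) → Fin n))
    (u : Fin (k + 1) → Fin n → Fin n → ℤ) (f : (Fin (k + 1) → Fin n) → ℕ)
    (hu : ∀ i, ∑ j, u j (maMuRow i j) (maMuCol i j) = f i) (hf : ∀ i, f i = 0 ↔ i ∈ Φ)
    (hΦ : ∀ i ∈ Φ, ∀ i' ∈ Φ, ∀ j, maMuRow i j = maMuRow i' j → maMuCol i j = maMuCol i' j →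
      i = i') :
    DegeneratesTo (MaMu fun _ : Fin (k + 1) => n) (unitTensor (Fin (k + 1)) Φ.card) := by
  let W := ⨂[ℂ] _ : Fin (k + 1), (Fin Φ.card → ℂ)
  let : TopologicalSpace W := moduleTopology ℂ W
  have : IsModuleTopology ℂ W := ⟨rfl⟩
  have : ContinuousAdd W := IsModuleTopology.toContinuousAdd ℂ W
  let e := Φ.equivFin
  -- Coordinate `l` tests whether the index pair in factor `j` is that of the `l`-th tuple of `Φ`.
  -- By `hΦ`, a tuple of `Φ` yields the same unit vector in every factor.
  let w : Fin (k + 1) → Fin n → Fin n → Fin Φ.card → ℂ := fun j a b l =>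
    if maMuRow (e.symm l).1 j = a ∧ maMuCol (e.symm l).1 j = b then 1 else 0
  let v : (Fin (k + 1) → Fin n) → W := fun i =>
    PiTensorProduct.tprod ℂ fun j => w j (maMuRow i j) (maMuCol i j)
  let γ : ℂ → W := fun t => ∑ i, t ^ f i • v i
  have hγ : Continuous γ := continuous_finsetSum _ fun i _ =>
    Continuous.fun_smul (continuous_pow (f i)) continuous_const
  have hv : ∀ l, v (e.symm l).1 = PiTensorProduct.tprod ℂ fun _ => Pi.single l 1 := fun l => by
    simp only [v]
    congr 1
    funext j l'
    simp only [w, Pi.single_apply]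
    refine if_congr ⟨fun h => ?_, fun h => by rw [h]; exact ⟨rfl, rfl⟩⟩ rfl rfl
    exact e.symm.injective (Subtype.ext (hΦ _ (e.symm l').2 _ (e.symm l).2 j h.1 h.2))
  have hγ0 : γ 0 = unitTensor (Fin (k + 1)) Φ.card := by
    have h1 : γ 0 = ∑ i ∈ Φ, v i := by
      simp only [γ]
      rw [← Finset.sum_subset (Finset.subset_univ Φ)]
      · refine Finset.sum_congr rfl fun i hi => ?_
        rw [(hf i).2 hi, pow_zero, one_smul]
      · intro i _ hi
        rw [zero_pow (fun h => hi ((hf i).1 h)), zero_smul]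
    rw [h1, unitTensor, ← Finset.sum_coe_sort Φ, ← e.symm.sum_comp]
    exact Finset.sum_congr rfl fun l _ => hv l
  have hsub : γ '' {0}ᶜ ⊆ Set.range fun A :
      ∀ j, MaMuSpace (fun _ : Fin (k + 1) => n) j →ₗ[ℂ] (Fin Φ.card → ℂ) =>
        PiTensorProduct.map A (MaMu fun _ : Fin (k + 1) => n) := by
    rintro _ ⟨t, ht, rfl⟩
    -- For `t ≠ 0` negative weights are allowed: only the total exponent `f i` has to be nonnegative
    -- for the curve to extend to `t = 0`.
    obtain ⟨A, hA⟩ := exists_linearMap_maMuBasis fun j a b => t ^ u j a b • w j a b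
    refine ⟨A, ?_⟩
    simp only [map_MaMu, hA]
    refine Finset.sum_congr rfl fun i _ => ?_
    rw [MultilinearMap.map_smul_univ]
    congr 1
    rw [← zpow_natCast, ← hu, prod_zpow_eq_zpow_sum ht]
  have h0 : (0 : ℂ) ∈ closure {0}ᶜ := dense_compl_singleton (0 : ℂ) 0
  have := closure_mono hsub (hγ.continuousWithinAt.mem_closure_image h0)
  rw [hγ0] at this
  exact this

theorem Fin.sum_succ_sub_castSucc {K : ℕ} (x : Fin (K + 1) → ℤ) :
    ∑ j : Fin K, (x j.succ - x j.castSucc) = x (Fin.last K) - x 0 := by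
  have h := (Fin.sum_univ_succ x).symm.trans (Fin.sum_univ_castSucc x)
  rw [Finset.sum_sub_distrib]
  linarith

/-! ### Arithmetic progressions and the lower bound -/

section Progression

variable {K n : ℕ}

/-- The tuples whose entries after the first one form an arithmetic progression, with difference
the first entry shifted by `o`. -/
def progressionSet (K n : ℕ) (o : ℤ) : Finset (Fin (K + 1 + 1) → Fin n) :=
  Finset.univ.filter fun i =>
    ∀ j : Fin K, ((i j.succ.succ : ℕ) : ℤ) - (i j.castSucc.succ : ℕ) = (i 0 : ℕ) - o

theorem mem_progressionSet {o : ℤ} {i : Fin (K + 1 + 1) → Fin n} :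
    i ∈ progressionSet K n o ↔
      ∀ j : Fin K, ((i j.succ.succ : ℕ) : ℤ) - (i j.castSucc.succ : ℕ) = (i 0 : ℕ) - o := by
  simp [progressionSet]

theorem eq_of_mem_progressionSet {o : ℤ} {i : Fin (K + 1 + 1) → Fin n}
    (hi : i ∈ progressionSet K n o) (j : Fin (K + 1)) :
    ((i j.succ : ℕ) : ℤ) = (i (Fin.succ 0) : ℕ) + j * ((i 0 : ℕ) - o) := by
  rw [mem_progressionSet] at hi
  induction j using Fin.induction with
  | zero => simp
  | succ j ih =>
    have := hi j
    rw [Fin.val_castSucc] at ih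
    rw [Fin.val_succ]
    push_cast
    linarith

theorem progressionSet_injective {o : ℤ} {i i' : Fin (K + 1 + 1) → Fin n}
    (hi : i ∈ progressionSet K n o) (hi' : i' ∈ progressionSet K n o)
    (h0 : i 0 = i' 0) (h1 : i (Fin.succ 0) = i' (Fin.succ 0)) : i = i' := by
  funext j
  refine Fin.cases h0 (fun j => ?_) j
  have h2 := eq_of_mem_progressionSet hi j
  rw [h0, h1, ← eq_of_mem_progressionSet hi' j] at h2
  exact Fin.ext (by exact_mod_cast h2)

/-- The weights of the monomial degeneration to the progressions. -/
def progressionWeight (K n : ℕ) (o : ℤ) : Fin (K + 1 + 1) → Fin n → Fin n → ℤ :=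
  Fin.cases (fun a b => -2 * b * ((a : ℕ) - o) + K * ((a : ℕ) - o) ^ 2)
    (Fin.cases (fun a b => 2 * b * ((a : ℕ) - o)) fun _ a b => (((b : ℕ) : ℤ) - (a : ℕ)) ^ 2)

/-- In the expanded squares the cross terms telescope to (iₖ - i₁)(i₀ - o). Hence every term depends
on a single pair of cyclically adjacent indices and can be charged to one factor. -/
theorem sum_progressionWeight (o : ℤ) (i : Fin (K + 1 + 1) → Fin n) :
    ∑ j, progressionWeight K n o j (maMuRow i j) (maMuCol i j) =
    ∑ j : Fin K, (((i j.succ.succ : ℕ) : ℤ) - (i j.castSucc.succ : ℕ) - ((i 0 : ℕ) - o)) ^ 2 := by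
  have htel := Fin.sum_succ_sub_castSucc fun j : Fin (K + 1) => ((i j.succ : ℕ) : ℤ)
  have hexp : ∀ j : Fin K,
      (((i j.succ.succ : ℕ) : ℤ) - (i j.castSucc.succ : ℕ) - ((i 0 : ℕ) - o)) ^ 2 =
      (((i j.succ.succ : ℕ) : ℤ) - (i j.castSucc.succ : ℕ)) ^ 2 -
        2 * ((i 0 : ℕ) - o) * (((i j.succ.succ : ℕ) : ℤ) - (i j.castSucc.succ : ℕ)) +
        ((i 0 : ℕ) - o) ^ 2 := fun j => by ring
  rw [Finset.sum_congr rfl fun j _ => hexp j, Finset.sum_add_distrib, Finset.sum_sub_distrib,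
    ← Finset.mul_sum, htel, Fin.sum_univ_succ, Fin.sum_univ_succ]
  simp only [progressionWeight, maMuRow, maMuCol, Fin.cases_zero, Fin.cases_succ,
    Finset.sum_const, Finset.card_univ, Fintype.card_fin, nsmul_eq_mul, Fin.castSucc_zero,
    Fin.succ_last, ← Fin.succ_castSucc]
  ring

theorem degeneratesTo_card_progressionSet (o : ℤ) (hK : 0 < K) :
    DegeneratesTo (MaMu fun _ : Fin (K + 1 + 1) => n)
      (unitTensor (Fin (K + 1 + 1)) (progressionSet K n o).card) := by
  refine degeneratesTo_unitTensor_of_weights _ (progressionWeight K n o)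
    (fun i => (∑ j : Fin K, (((i j.succ.succ : ℕ) : ℤ) - (i j.castSucc.succ : ℕ) -
      ((i 0 : ℕ) - o)) ^ 2).toNat) ?_ ?_ ?_
  · intro i
    rw [sum_progressionWeight, Int.toNat_of_nonneg (Finset.sum_nonneg fun _ _ => sq_nonneg _)]
  · intro i
    rw [Int.toNat_eq_zero, (Finset.sum_nonneg fun _ _ => sq_nonneg _).ge_iff_eq',
      Finset.sum_eq_zero_iff_of_nonneg (fun _ _ => sq_nonneg _), mem_progressionSet]
    simp [sub_eq_zero]
  · intro i hi i' hi' j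
    -- Factor 0 fixes the difference and the last entry; the first entry of the progression follows
    -- by subtracting `K` differences.
    have hK' : (K : ℤ) ≠ 0 := by exact_mod_cast hK.ne'
    refine Fin.cases ?_ (Fin.cases ?_ fun j => ?_) j
    · intro h0 h1
      change i 0 = i' 0 at h0
      change i (Fin.last K).succ = i' (Fin.last K).succ at h1
      refine progressionSet_injective hi hi' h0 (Fin.ext ?_)
      have h2 := eq_of_mem_progressionSet hi (Fin.last K)
      have h3 := eq_of_mem_progressionSet hi' (Fin.last K)
      rw [h1, h0] at h2
      omega
    · exact progressionSet_injective hi hi'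
    · intro h0 h1
      change i j.castSucc.succ = i' j.castSucc.succ at h0
      change i j.succ.succ = i' j.succ.succ at h1
      have h2 := mem_progressionSet.1 hi j
      have h3 := mem_progressionSet.1 hi' j
      rw [h0, h1] at h2
      have h4 : i 0 = i' 0 := Fin.ext (by omega)
      have h5 := eq_of_mem_progressionSet hi j.castSucc
      have h6 := eq_of_mem_progressionSet hi' j.castSucc
      rw [h0, h4] at h5
      exact progressionSet_injective hi hi' h4 (Fin.ext (by omega))

/-- Cauchy–Schwarz for the sizes of the `K` residue classes. -/
theorem sq_le_mul_card_congruent (K n : ℕ) (hK : 0 < K) :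
    n ^ 2 ≤ K * ((Finset.univ : Finset (Fin n × Fin n)).filter
      fun p => (p.1 : ℕ) % K = (p.2 : ℕ) % K).card := by
  let N : ℕ → ℕ := fun c => ((Finset.univ : Finset (Fin n)).filter fun a : Fin n => (a : ℕ) % K = c).card
  have h1 : n = ∑ c ∈ Finset.range K, N c := by
    have := Finset.card_eq_sum_card_fiberwise (s := (Finset.univ : Finset (Fin n)))
      (t := Finset.range K) (f := fun a : Fin n => (a : ℕ) % K)
      (fun a _ => by simpa using Nat.mod_lt _ hK)
    simpa using this
  have h2 : ((Finset.univ : Finset (Fin n × Fin n)).filter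
      fun p => (p.1 : ℕ) % K = (p.2 : ℕ) % K).card = ∑ c ∈ Finset.range K, N c ^ 2 := by
    rw [Finset.card_eq_sum_card_fiberwise (t := Finset.range K)
      (f := fun p : Fin n × Fin n => (p.1 : ℕ) % K)
      (fun a _ => by simpa using Nat.mod_lt _ hK)]
    refine Finset.sum_congr rfl fun c _ => ?_
    rw [pow_two, ← Finset.card_product]
    congr 1
    ext ⟨a, b⟩
    simp only [Finset.mem_filter, Finset.mem_univ, true_and, Finset.mem_product]
    omega
  have h3 := sq_sum_le_card_mul_sum_sq (s := Finset.range K) (f := N)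
  rw [Finset.card_range, ← h1, ← h2] at h3
  exact h3

theorem card_congruent_le_card_progressionSet (K n : ℕ) (hK : 2 ≤ K) (hn : 0 < n) :
    ((Finset.univ : Finset (Fin n × Fin n)).filter
      fun p => (p.1 : ℕ) % K = (p.2 : ℕ) % K).card ≤
      (progressionSet K n ((n - 1) / 2 : ℕ)).card := by
  have key : ∀ p : Fin n × Fin n, (p.1 : ℕ) % K = (p.2 : ℕ) % K →
      ∃ i ∈ progressionSet K n ((n - 1) / 2 : ℕ), i (Fin.succ 0) = p.1 ∧
        i (Fin.last K).succ = p.2 := by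
    rintro ⟨a, b⟩ hab
    obtain ⟨D, hD⟩ : (K : ℤ) ∣ (b : ℕ) - (a : ℕ) := (Nat.modEq_iff_dvd).1 hab
    have hK' : (2 : ℤ) ≤ K := by exact_mod_cast hK
    have ha := a.2
    have hb := b.2
    -- Since |K D| ≤ n - 1 and K ≥ 2, the difference satisfies |D| ≤ (n - 1) / 2. The central offset
    -- then puts i₀ = D + o in range.
    have hD1 : 2 * D ≤ n - 1 := by
      rcases le_or_gt D 0 with h | h
      · omega
      · nlinarith
    have hD2 : -(n - 1 : ℤ) ≤ 2 * D := by
      rcases le_or_gt 0 D with h | h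
      · omega
      · nlinarith
    have hj : ∀ j : Fin (K + 1), 0 ≤ (a : ℕ) + (j : ℕ) * D ∧ (a : ℕ) + (j : ℕ) * D < n := by
      intro j
      have h1 : ((j : ℕ) : ℤ) ≤ K := by exact_mod_cast Nat.lt_succ_iff.1 j.2
      have h2 : (0 : ℤ) ≤ ((j : ℕ) : ℤ) := by positivity
      rcases le_or_gt D 0 with h | h
      · constructor
        · nlinarith
        · nlinarith
      · constructor
        · positivity
        · nlinarith
    let i : Fin (K + 1 + 1) → Fin n := Fin.cases
      ⟨(D + ((n - 1) / 2 : ℕ)).toNat, by omega⟩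
      fun j => ⟨((a : ℕ) + (j : ℕ) * D).toNat, by have := hj j; omega⟩
    have hi0 : (((i 0 : Fin n) : ℕ) : ℤ) = D + ((n - 1) / 2 : ℕ) :=
      Int.toNat_of_nonneg (by omega)
    have hij : ∀ j : Fin (K + 1), (((i j.succ : Fin n) : ℕ) : ℤ) = (a : ℕ) + (j : ℕ) * D :=
      fun j => Int.toNat_of_nonneg (hj j).1
    refine ⟨i, mem_progressionSet.2 fun j => ?_, Fin.ext ?_, Fin.ext ?_⟩
    · rw [hij, hij, hi0, Fin.val_succ, Fin.val_castSucc]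
      push_cast
      ring
    · have := hij 0
      simp only [Fin.val_zero, Nat.cast_zero, zero_mul, add_zero] at this
      exact_mod_cast this
    · have := hij (Fin.last K)
      rw [Fin.val_last, ← hD] at this
      change ((i (Fin.last K).succ : Fin n) : ℕ) = (b : ℕ)
      omega
  have : Nonempty (Fin n) := ⟨⟨0, hn⟩⟩
  choose! g hg using key
  refine Finset.card_le_card_of_injOn g (fun p hp => (hg p (Finset.mem_filter.1 hp).2).1) ?_
  intro p hp p' hp' h
  have h1 := (hg p (Finset.mem_filter.1 hp).2).2
  have h2 := (hg p' (Finset.mem_filter.1 hp').2).2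
  rw [h] at h1
  exact Prod.ext (h1.1.symm.trans h2.1) (h1.2.symm.trans h2.2)

end Progression

/-! ### Both bounds combined -/

theorem mainTheorem1 (k n q r : ℕ) (hk : 3 ≤ k) (hn : 2 ≤ n)
    (hq : q = n / k) (hr : r = n - q * k) :
    IsGreatest {m : ℕ | DegeneratesTo (MaMu fun _ : Fin (k + 1) => n) (unitTensor (Fin (k + 1)) m)}
        (borderSubrank (MaMu fun _ : Fin (k + 1) => n)) ∧
      (n : ℝ) ^ 2 / ((k : ℝ) - 1) ≤ (borderSubrank (MaMu fun _ : Fin (k + 1) => n) : ℝ) ∧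
      (borderSubrank (MaMu fun _ : Fin (k + 1) => n) : ℝ) ≤
        1 / 2 * ((n : ℝ) ^ 2 + (n : ℝ) * (q : ℝ) + (r : ℝ) * ((q : ℝ) + 1)) := by
  obtain ⟨K, rfl⟩ : ∃ K, k = K + 1 := ⟨k - 1, by omega⟩
  have hupper : ∀ m ∈ {m : ℕ | DegeneratesTo (MaMu fun _ : Fin (K + 1 + 1) => n)
      (unitTensor (Fin (K + 1 + 1)) m)}, 2 * m ≤ n ^ 2 + n * q + r * (q + 1) :=
    fun m hm => two_mul_le_of_degeneratesTo (by omega) hq hr hm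
  have hbdd : BddAbove {m : ℕ | DegeneratesTo (MaMu fun _ : Fin (K + 1 + 1) => n)
      (unitTensor (Fin (K + 1 + 1)) m)} :=
    ⟨n ^ 2 + n * q + r * (q + 1), fun m hm => by have := hupper m hm; omega⟩
  have hmem := degeneratesTo_card_progressionSet (K := K) (n := n) ((n - 1) / 2 : ℕ) (by omega)
  have hgreatest : IsGreatest {m : ℕ | DegeneratesTo (MaMu fun _ : Fin (K + 1 + 1) => n)
      (unitTensor (Fin (K + 1 + 1)) m)} (borderSubrank (MaMu fun _ : Fin (K + 1 + 1) => n)) :=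
    ⟨Nat.sSup_mem ⟨_, hmem⟩ hbdd, fun m hm => le_csSup hbdd hm⟩
  refine ⟨hgreatest, ?_, ?_⟩
  · have h1 : n ^ 2 ≤ K * borderSubrank (MaMu fun _ : Fin (K + 1 + 1) => n) :=
      (sq_le_mul_card_congruent K n (by omega)).trans (Nat.mul_le_mul_left K
        ((card_congruent_le_card_progressionSet K n (by omega) (by omega)).trans
          (hgreatest.2 hmem)))
    have hK : (0 : ℝ) < K := by exact_mod_cast (by omega : 0 < K)
    rw [Nat.cast_add, Nat.cast_one, add_sub_cancel_right, div_le_iff₀' hK]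
    exact_mod_cast h1
  · have h1 : (2 : ℝ) * (borderSubrank (MaMu fun _ : Fin (K + 1 + 1) => n) : ℝ) ≤
        (n : ℝ) ^ 2 + n * q + r * (q + 1) := by exact_mod_cast hupper _ hgreatest.1
    linarith
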